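/- Let $T$ be a Bienaymé–Galton–Watson tree with root $\rho$ and offspring distribution $L$, where $\mathbb E[L]=m\in[1,\infty)$ and $\mathbb E[L\log_+L]<\infty$. Independently of $T$, attach i.i.d. Uniform$(0,1)$ random variables $U_v$ to its vertices, and for $\theta\in[0,1]$ put $X_v=U_v+\theta\,d(\rho,v)$, where $d$ is the graph distance (the Rough Mount Fuji model). Then for every $\theta\in[0,1]$ with $\theta>1-\sqrt{1-1/m}$, $$\mathbb P(\text{there is an infinite path in } T \text{ started from } \rho \text{ along which the labels } X_v \text{ are strictly increasing})>0 .$$ In particular, $$\theta_c(m)\le 1-\sqrt{1-\tfrac1m},\qquad\text{where } 1-\sqrt{1-\tfrac1m}\sim\tfrac1{2m}\ \text{ as } m\to\infty .$$ Here the bound holds for $\theta_c(m)$ in both of the following senses: 1. the critical parameter of the model on $T$, i.e. the supremum of the $\theta\in[0,1]$ for which the probability above is zero; 2. the value $\theta_c(m)\in(0,1]$ defined implicitly by $m_c(\theta_c(m))=m$, where for $\theta\in(0,1]$ one writes $m_c(\theta)$ for the minimal real root of $$Q_\theta(x)=\sum_{j=0}^{\lfloor 1/\theta\rfloor+1}\frac{(-x)^j}{j!}\bigl(1-(j-1)\theta\bigr)^j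 ;$$ that is, every $t\in(0,1]$ with $m_c(t)=m$ satisfies $t\le 1-\sqrt{1-1/m}$. -/

import Mathlib

open MeasureTheory ProbabilityTheory Filter Asymptotics
open scoped Nat

/-- The rooted tree with offspring numbers `N`, in Ulam-Harris notation: vertices are finite words
of natural numbers, the root is the empty word, and the children of `w` are the words `w ++ [i]`
with `i < N w`. -/
def offspringTree (N : List ℕ → ℕ) : Set (List ℕ) :=
  {v | ∀ (w : List ℕ) (i : ℕ), w ++ [i] <+: v → i < N w}

/-- The Rough Mount Fuji label `X_v = U_v + θ d(ρ, v)`; in a tree of words, the graph distance from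
the root to `v` is the length of `v`. -/
def rmfLabel (U : List ℕ → ℝ) (θ : ℝ) (v : List ℕ) : ℝ :=
  U v + θ * (v.length : ℝ)

/-- Accessibility percolation: there is an infinite path in the tree, started at the root, along
which the labels are strictly increasing. (An infinite simple path from the root of a tree moves
from a vertex to one of its children at each step.) -/
def AccessibilityPercolation (N : List ℕ → ℕ) (U : List ℕ → ℝ) (θ : ℝ) : Prop :=
  ∃ p : ℕ → List ℕ, p 0 = [] ∧ (∀ n, p n ∈ offspringTree N) ∧
    (∀ n, ∃ i : ℕ, p (n + 1) = p n ++ [i]) ∧ StrictMono fun n => rmfLabel U θ (p n)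

/-- The random variables `N v` and `U v` realise a Bienaymé-Galton-Watson tree with offspring
distribution `ν` and, independently of it, i.i.d. Uniform(0,1) variables at the vertices. -/
structure IsBGWWithUniforms {Ω : Type*} [MeasurableSpace Ω] (P : Measure Ω) (ν : Measure ℕ)
    (N : List ℕ → Ω → ℕ) (U : List ℕ → Ω → ℝ) : Prop where
  measurable_offspring : ∀ v, Measurable (N v)
  measurable_uniform : ∀ v, Measurable (U v)
  law_offspring : ∀ v, P.map (N v) = ν
  law_uniform : ∀ v, P.map (U v) = volume.restrict (Set.Ioo (0 : ℝ) 1)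
  indep_offspring : iIndepFun N P
  indep_uniform : iIndepFun U P
  indep_offspring_uniform : IndepFun (fun ω v => N v ω) (fun ω v => U v ω) P

/-- The event of accessibility percolation with parameter `θ`. -/
def percolationEvent {Ω : Type*} (N : List ℕ → Ω → ℕ) (U : List ℕ → Ω → ℝ) (θ : ℝ) : Set Ω :=
  {ω | AccessibilityPercolation (fun v => N v ω) (fun v => U v ω) θ}

/-- The critical parameter of the percolation model: the supremum of the `θ ∈ [0,1]` for which
accessibility percolation has probability zero. -/
noncomputable def criticalTheta {Ω : Type*} [MeasurableSpace Ω] (P : Measure Ω)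
    (N : List ℕ → Ω → ℕ) (U : List ℕ → Ω → ℝ) : ℝ :=
  sSup {θ : ℝ | 0 ≤ θ ∧ θ ≤ 1 ∧ P (percolationEvent N U θ) = 0}

/-- `Q_θ(x) = ∑_{j=0}^{⌊1/θ⌋+1} (-x)^j / j! * (1 - (j-1)θ)^j`. -/
noncomputable def criticalPoly (θ x : ℝ) : ℝ :=
  ∑ j ∈ Finset.range (⌊1 / θ⌋₊ + 2), (-x) ^ j / (j ! : ℝ) * (1 - ((j : ℝ) - 1) * θ) ^ j

/-- `m = m_c(θ)`: `m` is the minimal root of `Q_θ`. -/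
def IsCriticalMean (θ m : ℝ) : Prop :=
  IsLeast {x : ℝ | criticalPoly θ x = 0} m

/-! Write `λ = θ(2-θ)` and `T f(u) = ∫_{(u-θ)⁺}^1 f`. A child continues an increasing path from a
vertex with uniform variable `u` exactly when its own uniform variable exceeds `u - θ`. So `m T` is
the mean operator of a branching process with types in `[0,1]`, and survival should follow from a
nonnegative `φ ≠ 0` with `T φ ≥ λ φ` and `m λ > 1`. The last inequality reads `(1-θ)² < 1 - 1/m`,
which is the bound on `θ`. Take `φ` (`subEigen`) equal to 1 up to `θ` and then falling with slope
`-1/λ` until it reaches 0. Since `φ ≤ 1` and `∫ φ ≥ λ`, removing `[0, (u-θ)⁺]` leaves `T φ(u) ≥ λ -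
(u-θ)⁺` (`mul_subEigen_le_integral`).

Percolation: for small `δ`, the tail of `δ φ` stays below the tail of the label of a vertex with an
accessible path of length `n` below it, uniformly in `n` (`lintegral_subEigen_le`). Continuity of
measure and König's lemma turn this into an infinite path.

Critical polynomial: `Q_θ(x) = F_x(1+θ)`, where `F_x` solves a delay equation. Without a root up to
`1/λ`, the function `F = F_{1/λ}` would be positive with `T F < λ F` on `[0,1]`. At a maximum of `φ
/ F` this contradicts `T φ ≥ λ φ`. -/

/-! ### The test function -/

/-- A subeigenfunction, for the eigenvalue `θ (2 - θ)`, of the operator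
`f ↦ fun x ↦ ∫ y in (x - θ)⁺..1, f y` on functions on `[0, 1]`. -/
noncomputable def subEigen (θ u : ℝ) : ℝ :=
  max 0 (1 - max 0 (u - θ) / (θ * (2 - θ)))

lemma subEigen_nonneg (θ u : ℝ) : 0 ≤ subEigen θ u := le_max_left _ _

lemma subEigen_rate_pos {θ : ℝ} (h0 : 0 < θ) (h1 : θ ≤ 1) : 0 < θ * (2 - θ) :=
  mul_pos h0 (by linarith)

lemma subEigen_le_one {θ : ℝ} (h0 : 0 < θ) (h1 : θ ≤ 1) (u : ℝ) : subEigen θ u ≤ 1 := by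
  have := subEigen_rate_pos h0 h1
  refine max_le zero_le_one ?_
  have : 0 ≤ max 0 (u - θ) / (θ * (2 - θ)) := by positivity
  linarith

lemma continuous_subEigen (θ : ℝ) : Continuous (subEigen θ) := by
  unfold subEigen
  fun_prop

lemma subEigen_eq_one {θ u : ℝ} (hu : u ≤ θ) : subEigen θ u = 1 := by
  simp [subEigen, max_eq_left (sub_nonpos.2 hu)]

lemma le_integral_subEigen {θ : ℝ} (h0 : 0 < θ) (h1 : θ ≤ 1) :
    θ * (2 - θ) ≤ ∫ u in (0 : ℝ)..1, subEigen θ u := by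
  have hl := subEigen_rate_pos h0 h1
  have hint : ∀ a b, IntervalIntegrable (subEigen θ) volume a b :=
    fun a b => (continuous_subEigen θ).intervalIntegrable a b
  have hlow : ∀ u, θ ≤ u → 1 - (u - θ) / (θ * (2 - θ)) ≤ subEigen θ u := by
    intro u hu
    rw [subEigen, max_eq_right (sub_nonneg.2 hu)]
    exact le_max_right _ _
  have hfirst : ∫ u in (0 : ℝ)..θ, subEigen θ u = θ := by
    rw [intervalIntegral.integral_congr (g := fun _ => (1 : ℝ))]
    · simp
    · intro u hu
      rw [Set.uIcc_of_le h0.le] at hu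
      exact subEigen_eq_one hu.2
  -- Only a stretch of length `s` of the ramp is kept. It is cut below at 1 when `λ ≥ 1/2`, and at
  -- the zero `θ + λ` of the ramp otherwise.
  have hmid : ∀ s, 0 ≤ s → θ + s ≤ 1 →
      s - s ^ 2 / (2 * (θ * (2 - θ))) ≤ ∫ u in θ..1, subEigen θ u := by
    intro s hs hs1
    have hcomp : ∫ u in θ..(θ + s), (1 - (u - θ) / (θ * (2 - θ)))
        = s - s ^ 2 / (2 * (θ * (2 - θ))) := by
      have hd : ∀ u ∈ Set.uIcc θ (θ + s), HasDerivAt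
          (fun u => u - (u - θ) ^ 2 / (2 * (θ * (2 - θ)))) (1 - (u - θ) / (θ * (2 - θ))) u := by
        intro u _
        have := (hasDerivAt_id u).sub
          ((((hasDerivAt_id u).sub_const θ).pow 2).div_const (2 * (θ * (2 - θ))))
        refine this.congr_deriv ?_
        simp only [id]
        field_simp
        ring
      rw [intervalIntegral.integral_eq_sub_of_hasDerivAt hd
        (Continuous.intervalIntegrable (by fun_prop) _ _)]
      ring
    rw [← hcomp, ← intervalIntegral.integral_add_adjacent_intervals (hint θ (θ + s)) (hint (θ + s) 1)]
    have h2 : 0 ≤ ∫ u in (θ + s)..1, subEigen θ u :=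
      intervalIntegral.integral_nonneg hs1 fun u _ => subEigen_nonneg θ u
    have h3 : ∫ u in θ..(θ + s), (1 - (u - θ) / (θ * (2 - θ)))
        ≤ ∫ u in θ..(θ + s), subEigen θ u :=
      intervalIntegral.integral_mono_on (by linarith)
        (Continuous.intervalIntegrable (by fun_prop) _ _) (hint _ _) fun u hu => hlow u hu.1
    linarith
  rw [← intervalIntegral.integral_add_adjacent_intervals (hint 0 θ) (hint θ 1), hfirst]
  rcases le_total (1 / 2) (θ * (2 - θ)) with h | h
  · have := hmid (1 - θ) (by linarith) (by linarith)
    have h4 : (1 - θ) ^ 2 / (2 * (θ * (2 - θ))) ≤ (1 - θ) ^ 2 :=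
      div_le_self (sq_nonneg _) (by linarith)
    nlinarith
  · have := hmid (θ * (2 - θ)) hl.le (by nlinarith)
    have h4 : (θ * (2 - θ)) ^ 2 / (2 * (θ * (2 - θ))) = θ * (2 - θ) / 2 := by
      field_simp
    nlinarith

lemma mul_subEigen_le_integral {θ : ℝ} (h0 : 0 < θ) (h1 : θ ≤ 1) {u : ℝ} (hu : u ≤ 1) :
    θ * (2 - θ) * subEigen θ u ≤ ∫ y in (max 0 (u - θ))..1, subEigen θ y := by
  have hl := subEigen_rate_pos h0 h1
  have hint : ∀ a b, IntervalIntegrable (subEigen θ) volume a b :=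
    fun a b => (continuous_subEigen θ).intervalIntegrable a b
  have hb1 : max 0 (u - θ) ≤ 1 := max_le zero_le_one (by linarith)
  set b := max 0 (u - θ) with hb
  have hb0 : 0 ≤ b := le_max_left _ _
  have hn : 0 ≤ ∫ y in b..1, subEigen θ y :=
    intervalIntegral.integral_nonneg hb1 fun u _ => subEigen_nonneg θ u
  have hsplit := intervalIntegral.integral_add_adjacent_intervals (hint 0 b) (hint b 1)
  have hfirst : ∫ y in (0 : ℝ)..b, subEigen θ y ≤ b := by
    have := intervalIntegral.integral_mono_on hb0 (hint 0 b)
      (continuous_const.intervalIntegrable (μ := volume) 0 b)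
      (g := fun _ => (1 : ℝ)) fun u _ => subEigen_le_one h0 h1 u
    simpa using this
  have htot := le_integral_subEigen h0 h1
  rw [subEigen, mul_max_of_nonneg _ _ hl.le, ← hb]
  refine max_le (by simpa using hn) ?_
  rw [mul_sub, mul_div_cancel₀ _ hl.ne']
  linarith

/-! ### The threshold and its asymptotics -/

lemma one_lt_mul_of_lt {θ m : ℝ} (hm : 1 ≤ m) (h1 : θ ≤ 1) (h : 1 - √(1 - 1 / m) < θ) :
    1 < m * (θ * (2 - θ)) := by
  have hm0 : 0 < m := by linarith
  have hs : (0 : ℝ) ≤ 1 - 1 / m := by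
    rw [sub_nonneg, div_le_one hm0]
    exact hm
  have h2 : (1 - θ) ^ 2 < 1 - 1 / m := by
    rw [← Real.sq_sqrt hs]
    exact pow_lt_pow_left₀ (by linarith) (by linarith) two_ne_zero
  have h3 : m * (1 - θ) ^ 2 < m * (1 - 1 / m) := mul_lt_mul_of_pos_left h2 hm0
  rw [mul_sub, mul_one_div_cancel hm0.ne'] at h3
  nlinarith

lemma sqrt_bound_nonneg {m : ℝ} (hm : 1 ≤ m) : 0 ≤ 1 - √(1 - 1 / m) := by
  rw [sub_nonneg, Real.sqrt_le_one]
  have : 0 < 1 / m := by positivity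
  linarith

lemma isEquivalent_sqrt_bound :
    (fun x : ℝ => 1 - √(1 - 1 / x)) ~[atTop] (fun x : ℝ => 1 / (2 * x)) := by
  rw [isEquivalent_iff_tendsto_one]
  · have hlim : Tendsto (fun x : ℝ => 2 / (1 + √(1 - 1 / x))) atTop (nhds 1) := by
      have h1 : Tendsto (fun x : ℝ => 1 - 1 / x) atTop (nhds (1 - 0)) :=
        tendsto_const_nhds.sub (tendsto_const_nhds.div_atTop tendsto_id)
      have h2 := (tendsto_const_nhds (x := (1 : ℝ))).add h1.sqrt
      have h3 := (tendsto_const_nhds (x := (2 : ℝ))).div h2 (by norm_num)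
      have h4 : (2 : ℝ) / (1 + √(1 - 0)) = 1 := by norm_num
      rw [h4] at h3
      exact h3
    refine hlim.congr' ?_
    filter_upwards [eventually_ge_atTop 1] with x hx
    have hx0 : 0 < x := by linarith
    have hs : (0 : ℝ) ≤ 1 - 1 / x := by
      rw [sub_nonneg, div_le_one hx0]
      exact hx
    have h5 : 0 < 1 + √(1 - 1 / x) := by positivity
    have h6 : (1 - √(1 - 1 / x)) * (1 + √(1 - 1 / x)) = 1 / x := by
      have := Real.sq_sqrt hs
      nlinarith
    have h7 : 1 - √(1 - 1 / x) = 1 / x / (1 + √(1 - 1 / x)) := by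
      rw [eq_div_iff h5.ne', h6]
    simp only [Pi.div_apply]
    rw [h7]
    field_simp
  · filter_upwards [eventually_gt_atTop 0] with x hx
    intro h
    have : 0 < 1 / (2 * x) := by positivity
    exact absurd h this.ne'

/-! ### Offspring law near zero -/

/-- Truncating at `M` makes the quadratic error uniform in `k`, so no second moment of the offspring
law enters. With `j = min k M`, Bernoulli gives `(1-z)^j ≤ 1/(1+jz) ≤ 1 - jz + (jz)²`. -/
lemma one_sub_one_sub_pow_ge {z : ℝ} (h0 : 0 ≤ z) (h1 : z ≤ 1) (k M : ℕ) :
    (min k M : ℕ) * z - (M : ℝ) ^ 2 * z ^ 2 ≤ 1 - (1 - z) ^ k := by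
  set j := min k M with hj
  have hjM : (j : ℝ) ≤ M := by exact_mod_cast min_le_right _ _
  have h2 : (1 - z) ^ k ≤ (1 - z) ^ j :=
    pow_le_pow_of_le_one (by linarith) (by linarith) (min_le_left _ _)
  have h3 : 1 + (j : ℝ) * z ≤ (1 + z) ^ j := one_add_mul_le_pow (by linarith) j
  have h4 : (1 - z) ^ j * (1 + z) ^ j ≤ 1 := by
    rw [← mul_pow]
    exact pow_le_one₀ (by nlinarith) (by nlinarith)
  have h5 : 0 ≤ (1 - z) ^ j := pow_nonneg (by linarith) _
  have h6 : (1 - z) ^ j * (1 + j * z) ≤ 1 := (mul_le_mul_of_nonneg_left h3 h5).trans h4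
  have hjz : 0 ≤ (j : ℝ) * z := by positivity
  have h7 : (1 - z) ^ j ≤ 1 - j * z + (j * z) ^ 2 := by
    by_contra! hc
    nlinarith [mul_lt_mul_of_pos_right hc (by linarith : 0 < 1 + j * z), pow_nonneg hjz 3]
  have h8 : (j * z) ^ 2 ≤ (M : ℝ) ^ 2 * z ^ 2 := by
    rw [mul_pow]
    gcongr
  linarith

/-- A supercritical offspring law, after multiplication by `c < 1 / m`, dominates the identity
near zero. -/
lemma exists_survival_bound (ν : Measure ℕ) [IsProbabilityMeasure ν]
    (hint : Integrable (fun k : ℕ => (k : ℝ)) ν) {c : ℝ} (hc : c < ∫ k : ℕ, (k : ℝ) ∂ν) :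
    ∃ δ : ℝ, 0 < δ ∧ δ ≤ 1 ∧ ∀ z, 0 ≤ z → z ≤ δ → c * z ≤ ∫ k : ℕ, (1 - (1 - z) ^ k) ∂ν := by
  have hlim : Tendsto (fun M : ℕ => ∫ k : ℕ, ((min k M : ℕ) : ℝ) ∂ν) atTop
      (nhds (∫ k : ℕ, (k : ℝ) ∂ν)) := by
    refine tendsto_integral_of_dominated_convergence (fun k : ℕ => (k : ℝ))
      (fun M => (measurable_of_countable _).aestronglyMeasurable) hint ?_ ?_
    · refine fun M => Eventually.of_forall fun k => ?_
      rw [Real.norm_natCast]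
      exact_mod_cast min_le_left k M
    · refine Eventually.of_forall fun k => ?_
      refine tendsto_const_nhds.congr' ?_
      filter_upwards [eventually_ge_atTop k] with M hM
      rw [min_eq_left hM]
  obtain ⟨M, hM⟩ := (hlim.eventually (lt_mem_nhds hc)).exists
  set a := ∫ k : ℕ, ((min k M : ℕ) : ℝ) ∂ν with ha
  have hpos : 0 < a - c := by linarith
  refine ⟨min 1 ((a - c) / ((M : ℝ) ^ 2 + 1)), by positivity, min_le_left _ _, fun z hz hzd => ?_⟩
  have hz1 : z ≤ 1 := hzd.trans (min_le_left _ _)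
  have hz2 : z * ((M : ℝ) ^ 2 + 1) ≤ a - c := by
    rw [← le_div_iff₀ (by positivity)]
    exact hzd.trans (min_le_right _ _)
  have hintM : Integrable (fun k : ℕ => ((min k M : ℕ) : ℝ)) ν := by
    refine hint.mono (measurable_of_countable _).aestronglyMeasurable
      (Eventually.of_forall fun k => ?_)
    rw [Real.norm_natCast, Real.norm_natCast]
    exact_mod_cast min_le_left k M
  have hintp : Integrable (fun k : ℕ => (1 - (1 - z) ^ k)) ν := by
    refine (integrable_const (1 : ℝ)).mono (measurable_of_countable _).aestronglyMeasurable
      (Eventually.of_forall fun k => ?_)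
    have h1 : 0 ≤ (1 - z) ^ k := pow_nonneg (by linarith) _
    have h2 : (1 - z) ^ k ≤ 1 := pow_le_one₀ (by linarith) (by linarith)
    rw [Real.norm_of_nonneg (by linarith)]
    simpa using h1
  have hmono : ∫ k : ℕ, (((min k M : ℕ) : ℝ) * z - (M : ℝ) ^ 2 * z ^ 2) ∂ν
      ≤ ∫ k : ℕ, (1 - (1 - z) ^ k) ∂ν :=
    integral_mono ((hintM.mul_const z).sub (integrable_const _)) hintp
      fun k => one_sub_one_sub_pow_ge hz hz1 k M
  rw [integral_sub (hintM.mul_const z) (integrable_const _), integral_mul_const, ← ha] at hmono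
  simp only [integral_const, probReal_univ, one_smul] at hmono
  nlinarith

/-! ### The delay equation and the critical polynomial -/

/-- The solution `F` of the delay equation `F' s = -x * F (s - θ)` with `F = 1` on `[0, θ]`, as a
truncated delayed exponential series. -/
noncomputable def delayExp (θ : ℝ) (n : ℕ) (x s : ℝ) : ℝ :=
  ∑ j ∈ Finset.range n, (-x) ^ j / (j ! : ℝ) * (max 0 (s - j * θ)) ^ j

lemma continuous_delayExp (θ : ℝ) (n : ℕ) :
    Continuous fun p : ℝ × ℝ => delayExp θ n p.1 p.2 := by
  unfold delayExp
  fun_prop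

lemma delayExp_eq_one {θ : ℝ} (h0 : 0 < θ) (n : ℕ) (x : ℝ) {s : ℝ} (hs : s ≤ θ) :
    delayExp θ (n + 1) x s = 1 := by
  rw [delayExp, Finset.sum_range_succ', Finset.sum_eq_zero]
  · simp
  · intro j _
    have : s - ((j + 1 : ℕ) : ℝ) * θ ≤ 0 := by
      push_cast
      have : 0 ≤ (j : ℝ) * θ := by positivity
      linarith
    rw [max_eq_left this]
    simp

lemma delayExp_zero_left (θ : ℝ) (n : ℕ) (s : ℝ) : delayExp θ (n + 1) 0 s = 1 := by
  rw [delayExp, Finset.sum_range_succ', Finset.sum_eq_zero]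
  · simp
  · intro j _
    simp

/-- For `j = 0` the integrand is 1 even below `c`, because `0 ^ 0 = 1`; hence the hypothesis `hj`.
-/
lemma integral_posPart_pow {a b c : ℝ} (hab : a ≤ b) (j : ℕ) (hj : j ≠ 0 ∨ c ≤ a) :
    ∫ u in a..b, (max 0 (u - c)) ^ j
      = ((max 0 (b - c)) ^ (j + 1) - (max 0 (a - c)) ^ (j + 1)) / ((j : ℝ) + 1) := by
  rw [integral_eq_of_hasDerivAt_off_countable_of_le
    (fun u => (max 0 (u - c)) ^ (j + 1) / ((j : ℝ) + 1)) _ hab (Set.countable_singleton c)]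
  · ring
  · exact Continuous.continuousOn (by fun_prop)
  · rintro u ⟨hu, huc⟩
    rcases lt_or_gt_of_ne huc with h | h
    · have hj0 : j ≠ 0 := hj.resolve_right fun hca => by linarith [hu.1]
      have : HasDerivAt (fun _ : ℝ => (0 : ℝ)) ((max 0 (u - c)) ^ j) u := by
        rw [max_eq_left (by linarith), zero_pow hj0]
        exact hasDerivAt_const u 0
      refine this.congr_of_eventuallyEq ?_
      filter_upwards [Iio_mem_nhds h] with v hv
      rw [max_eq_left (by linarith [Set.mem_Iio.1 hv])]
      simp
    · have : HasDerivAt (fun v : ℝ => (v - c) ^ (j + 1) / ((j : ℝ) + 1)) ((max 0 (u - c)) ^ j) u := by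
        rw [max_eq_right (by linarith)]
        refine ((((hasDerivAt_id u).sub_const c).pow (j + 1)).div_const _).congr_deriv ?_
        simp only [id]
        push_cast
        field_simp
      refine this.congr_of_eventuallyEq ?_
      filter_upwards [Ioi_mem_nhds h] with v hv
      rw [max_eq_right (by linarith [Set.mem_Ioi.1 hv])]
  · exact Continuous.intervalIntegrable (by fun_prop) _ _

/-- Integrating term by term shifts the series by one index. The bound on `b` kills the top term, so
the same truncation appears on both sides. -/
lemma mul_integral_delayExp {θ a b : ℝ} (ha : 0 ≤ a) (hab : a ≤ b) {n : ℕ}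
    (hb : b ≤ n * θ) (x : ℝ) :
    x * ∫ u in a..b, delayExp θ (n + 1) x u
      = delayExp θ (n + 1) x (a + θ) - delayExp θ (n + 1) x (b + θ) := by
  have hI : ∫ u in a..b, delayExp θ (n + 1) x u = ∑ j ∈ Finset.range (n + 1),
      (-x) ^ j / (j ! : ℝ) *
        (((max 0 (b - j * θ)) ^ (j + 1) - (max 0 (a - j * θ)) ^ (j + 1)) / ((j : ℝ) + 1)) := by
    simp only [delayExp]
    rw [intervalIntegral.integral_finsetSum
      fun j _ => Continuous.intervalIntegrable (by fun_prop) _ _]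
    refine Finset.sum_congr rfl fun j _ => ?_
    rw [intervalIntegral.integral_const_mul, integral_posPart_pow hab]
    rcases eq_or_ne j 0 with rfl | h
    · simpa using ha
    · exact Or.inl h
  rw [hI, Finset.sum_range_succ, max_eq_left (show b - n * θ ≤ 0 by linarith),
    max_eq_left (show a - n * θ ≤ 0 by linarith), delayExp, delayExp, ← Finset.sum_sub_distrib,
    Finset.sum_range_succ', mul_add, Finset.mul_sum]
  have hz : x * ((-x) ^ n / (n ! : ℝ) * (((0 : ℝ) ^ (n + 1) - 0 ^ (n + 1)) / ((n : ℝ) + 1))) = 0 := by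
    simp
  rw [hz]
  congr 1
  · refine Finset.sum_congr rfl fun j _ => ?_
    have h1 : a + θ - ((j + 1 : ℕ) : ℝ) * θ = a - j * θ := by push_cast; ring
    have h2 : b + θ - ((j + 1 : ℕ) : ℝ) * θ = b - j * θ := by push_cast; ring
    rw [h1, h2, Nat.factorial_succ]
    push_cast
    field_simp
    ring
  · simp

lemma criticalPoly_eq_delayExp {θ : ℝ} (h0 : 0 < θ) (x : ℝ) :
    criticalPoly θ x = delayExp θ (⌊1 / θ⌋₊ + 1 + 1) x (1 + θ) := by
  refine Finset.sum_congr rfl fun j hj => ?_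
  have hj' : (j : ℝ) ≤ ⌊1 / θ⌋₊ + 1 := by
    have := Nat.lt_succ_iff.1 (Finset.mem_range.1 hj)
    exact_mod_cast this
  have hf : (⌊1 / θ⌋₊ : ℝ) * θ ≤ 1 := by
    rw [← le_div_iff₀ h0]
    exact Nat.floor_le (by positivity)
  have h : 0 ≤ 1 + θ - j * θ := by nlinarith
  rw [max_eq_right h]
  ring

/-- The minimal root of the critical polynomial is at most `1 / (θ (2 - θ))`. -/
lemma exists_criticalPoly_root {θ : ℝ} (h0 : 0 < θ) (h1 : θ ≤ 1) :
    ∃ x, x ≤ 1 / (θ * (2 - θ)) ∧ criticalPoly θ x = 0 := by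
  have hl := subEigen_rate_pos h0 h1
  set X := 1 / (θ * (2 - θ)) with hX
  have hX0 : 0 < X := by positivity
  set n := ⌊1 / θ⌋₊ + 1 with hn
  have hnθ : 1 ≤ (n : ℝ) * θ := by
    rw [← div_le_iff₀ h0, hn]
    push_cast
    exact (Nat.lt_floor_add_one _).le
  set F : ℝ → ℝ → ℝ := fun x s => delayExp θ (n + 1) x s with hF
  have hFc : Continuous (fun p : ℝ × ℝ => F p.1 p.2) := continuous_delayExp θ (n + 1)
  have hFc2 : ∀ x, Continuous (F x) := fun x => hFc.comp (by fun_prop : Continuous fun s => (x, s))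
  have hF0 : ∀ s, F 0 s = 1 := delayExp_zero_left θ n
  have hFone : ∀ x s, s ≤ θ → F x s = 1 := fun x s hs => delayExp_eq_one h0 n x hs
  have hFint : ∀ x a, 0 ≤ a → a ≤ 1 → x * ∫ u in a..1, F x u = F x (a + θ) - F x (1 + θ) :=
    fun x a ha ha1 => mul_integral_delayExp ha ha1 hnθ x
  by_contra! hroot
  have hne : ∀ x, x ≤ X → F x (1 + θ) ≠ 0 := fun x hx => by
    have := hroot x hx
    rwa [criticalPoly_eq_delayExp h0] at this
  -- The value at `x = 0` is 1, so a sign change would produce a root.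
  have hpos : ∀ x, 0 ≤ x → x ≤ X → 0 < F x (1 + θ) := by
    intro x hx hxX
    by_contra! hneg
    have hc : ContinuousOn (fun y => F y (1 + θ)) (Set.Icc 0 x) :=
      (hFc.comp (by fun_prop : Continuous fun y => (y, 1 + θ))).continuousOn
    obtain ⟨y, hy, hy0⟩ := intermediate_value_Icc' hx hc
      (show (0 : ℝ) ∈ Set.Icc (F x (1 + θ)) (F 0 (1 + θ)) from ⟨hneg, by rw [hF0]; norm_num⟩)
    exact hne y (hy.2.trans hxX) hy0
  have hge : ∀ x, 0 ≤ x → (∀ s ∈ Set.Icc 0 (1 + θ), 0 ≤ F x s) → ∀ s ∈ Set.Icc 0 (1 + θ),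
      F x s = 1 ∨ F x (1 + θ) ≤ F x s := by
    intro x hx hnn s hs
    rcases le_total s θ with h | h
    · exact Or.inl (hFone x s h)
    · right
      have h2 := hFint x (s - θ) (by linarith) (by linarith [hs.2])
      rw [sub_add_cancel] at h2
      have h3 : 0 ≤ ∫ u in (s - θ)..1, F x u :=
        intervalIntegral.integral_nonneg (by linarith [hs.2]) fun u hu =>
          hnn u ⟨by linarith [hu.1], by linarith [hu.2]⟩
      have := mul_nonneg hx h3
      linarith
  have hcompact : IsCompact (Set.Icc (0 : ℝ) (1 + θ)) := isCompact_Icc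
  have hnonempty : (Set.Icc (0 : ℝ) (1 + θ)).Nonempty := Set.nonempty_Icc.2 (by linarith)
  -- Let `x` grow from 0. If the minimum of `F x` ever vanished, then at that `x` the function would
  -- be nonnegative, and `hge` would bound it below by a positive number.
  have hall : ∀ s ∈ Set.Icc 0 (1 + θ), 0 < F X s := by
    set μ : ℝ → ℝ := fun x => sInf (F x '' Set.Icc 0 (1 + θ)) with hμ
    have hμc : Continuous μ := hcompact.continuous_sInf hFc
    have hμmin : ∀ x, ∃ s ∈ Set.Icc 0 (1 + θ), F x s = μ x ∧ ∀ t ∈ Set.Icc 0 (1 + θ), μ x ≤ F x t := by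
      intro x
      obtain ⟨s, hs, he, hle⟩ := hcompact.exists_sInf_image_eq_and_le hnonempty (hFc2 x).continuousOn
      exact ⟨s, hs, he.symm, fun t ht => he.trans_le (hle t ht)⟩
    have hμ0 : μ 0 = 1 := by
      obtain ⟨s, -, hs, -⟩ := hμmin 0
      rw [← hs, hF0]
    have hμX : 0 < μ X := by
      by_contra! hneg
      obtain ⟨y, hy, hy0⟩ := intermediate_value_Icc' hX0.le hμc.continuousOn
        (show (0 : ℝ) ∈ Set.Icc (μ X) (μ 0) from ⟨hneg, by rw [hμ0]; norm_num⟩)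
      obtain ⟨s, hs, hs0, hle⟩ := hμmin y
      rw [hy0] at hs0 hle
      rcases hge y hy.1 hle s hs with h | h
      · linarith
      · linarith [hpos y hy.1 hy.2]
    obtain ⟨s, -, -, hle⟩ := hμmin X
    exact fun t ht => hμX.trans_le (hle t ht)
  have hstrict : ∀ u ∈ Set.Icc (0 : ℝ) 1, X * (∫ y in (max 0 (u - θ))..1, F X y) < F X u := by
    intro u hu
    rw [hFint X _ (le_max_left _ _) (max_le zero_le_one (by linarith [hu.2]))]
    have h2 : F X (max 0 (u - θ) + θ) = F X u := by
      rcases le_total u θ with h | h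
      · rw [max_eq_left (by linarith), zero_add, hFone X u h, hFone X θ le_rfl]
      · rw [max_eq_right (by linarith), sub_add_cancel]
    rw [h2]
    linarith [hpos X hX0.le le_rfl]
  have hFpos : ∀ u ∈ Set.Icc (0 : ℝ) 1, 0 < F X u := fun u hu => hall u ⟨hu.1, by linarith [hu.2]⟩
  -- The maximum `c` of `φ / F` gives `φ ≤ c F` with equality at `u`. There `φ ≤ X T φ ≤ c X T F < c
  -- F = φ`.
  obtain ⟨u, hu, hmax⟩ := isCompact_Icc.exists_isMaxOn (Set.nonempty_Icc.2 (zero_le_one' ℝ))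
    (((continuous_subEigen θ).continuousOn (s := Set.Icc 0 1)).div (hFc2 X).continuousOn
      fun u hu => (hFpos u hu).ne')
  set c := subEigen θ u / F X u with hc
  have hle : ∀ v ∈ Set.Icc (0 : ℝ) 1, subEigen θ v ≤ c * F X v := by
    intro v hv
    have : subEigen θ v / F X v ≤ c := hmax hv
    rwa [div_le_iff₀ (hFpos v hv)] at this
  have hc0 : 0 < c := by
    have h2 := hle 0 ⟨le_rfl, zero_le_one⟩
    rw [subEigen_eq_one h0.le, hFone X 0 h0.le] at h2
    linarith
  have hb1 : max 0 (u - θ) ≤ 1 := max_le zero_le_one (by linarith [hu.2])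
  have h2 := mul_subEigen_le_integral h0 h1 hu.2
  have h3 : ∫ y in (max 0 (u - θ))..1, subEigen θ y ≤ ∫ y in (max 0 (u - θ))..1, c * F X y :=
    intervalIntegral.integral_mono_on hb1 ((continuous_subEigen θ).intervalIntegrable _ _)
      (((hFc2 X).const_mul c).intervalIntegrable _ _)
      fun y hy => hle y ⟨(le_max_left _ _).trans hy.1, hy.2⟩
  rw [intervalIntegral.integral_const_mul] at h3
  have h4 := mul_lt_mul_of_pos_left (hstrict u hu) hc0
  have h5 : subEigen θ u = c * F X u := by
    rw [hc, div_mul_cancel₀ _ (hFpos u hu).ne']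
  have h6 : subEigen θ u = X * (θ * (2 - θ) * subEigen θ u) := by
    rw [hX, ← mul_assoc, one_div_mul_cancel hl.ne', one_mul]
  have h7 := mul_le_mul_of_nonneg_left (h2.trans h3) hX0.le
  nlinarith

lemma IsCriticalMean.le_inv {θ m : ℝ} (h0 : 0 < θ) (h1 : θ ≤ 1) (h : IsCriticalMean θ m) :
    m * (θ * (2 - θ)) ≤ 1 := by
  obtain ⟨x, hx, hx0⟩ := exists_criticalPoly_root h0 h1
  rw [← le_div_iff₀ (subEigen_rate_pos h0 h1)]
  exact (h.2 hx0).trans hx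

/-! ### Finite and infinite accessible paths -/

lemma append_singleton_mem_offspringTree {N : List ℕ → ℕ} {v : List ℕ}
    (hv : v ∈ offspringTree N) {i : ℕ} (hi : i < N v) : v ++ [i] ∈ offspringTree N := by
  intro w j hw
  rcases List.prefix_concat_iff.1 hw with h | h
  · obtain ⟨rfl, hij⟩ := List.append_inj' h rfl
    obtain rfl : j = i := by simpa using hij
    exact hi
  · exact hv w j h

open Classical in
/-- The uniform label of `w` if an accessible path of length `n` descends from `w`, and `-2`
otherwise. -/
noncomputable def chainLabel (N : List ℕ → ℕ) (U : List ℕ → ℝ) (θ : ℝ) : ℕ → List ℕ → ℝ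
  | 0, w => U w
  | n + 1, w => if ∃ i < N w, U w - θ < chainLabel N U θ n (w ++ [i]) then U w else -2

section Deterministic

variable {N : List ℕ → ℕ} {U : List ℕ → ℝ} {θ : ℝ}

lemma chainLabel_succ_le (hU : ∀ v, -2 ≤ U v) (n : ℕ) (w : List ℕ) :
    chainLabel N U θ (n + 1) w ≤ chainLabel N U θ n w := by
  induction n generalizing w with
  | zero =>
    rw [chainLabel, chainLabel]
    split_ifs
    · exact le_rfl
    · exact hU w
  | succ n ih =>
    rw [chainLabel, chainLabel]
    split_ifs with h1 h2 h2
    · exact le_rfl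
    · obtain ⟨i, hi, hlt⟩ := h1
      exact absurd ⟨i, hi, hlt.trans_le (ih _)⟩ h2
    · exact hU w
    · exact le_rfl

lemma antitone_chainLabel (hU : ∀ v, -2 ≤ U v) (w : List ℕ) :
    Antitone fun n => chainLabel N U θ n w :=
  antitone_nat_of_succ_le fun n => chainLabel_succ_le hU n w

/-- If every child failed at some depth, all of the finitely many children would fail at the largest
such depth, by monotonicity. Since `U w - θ ≥ -2`, the default value never passes for a valid label.
-/
lemma exists_child_chainLabel (hU : ∀ v, -1 ≤ U v) (hθ : θ ≤ 1) {w : List ℕ}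
    (hw : ∀ n, -2 < chainLabel N U θ n w) :
    ∃ i < N w, U w - θ < U (w ++ [i]) ∧ ∀ n, -2 < chainLabel N U θ n (w ++ [i]) := by
  have hU2 : ∀ v, -2 ≤ U v := fun v => by linarith [hU v]
  obtain ⟨i, hi, h⟩ : ∃ i < N w, ∀ n, U w - θ < chainLabel N U θ n (w ++ [i]) := by
    by_contra! hc
    choose! k hk using hc
    have h1 := hw ((Finset.range (N w)).sup k + 1)
    rw [chainLabel] at h1
    split_ifs at h1 with h2
    · obtain ⟨i, hi, hlt⟩ := h2
      have := antitone_chainLabel (N := N) (θ := θ) hU2 (w ++ [i])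
        (Finset.le_sup (f := k) (Finset.mem_range.2 hi))
      exact absurd (hlt.trans_le this) (hk i hi).not_gt
    · exact lt_irrefl _ h1
  exact ⟨i, hi, h 0, fun n => lt_of_le_of_lt (by linarith [hU w]) (h n)⟩

/-- König's lemma for accessible paths. -/
lemma accessibilityPercolation_of_chainLabel (hU : ∀ v, -1 ≤ U v) (hθ : θ ≤ 1)
    (h : ∀ n, -2 < chainLabel N U θ n []) : AccessibilityPercolation N U θ := by
  choose f hf1 hf2 hf3 using
    fun v : {w : List ℕ // ∀ n, -2 < chainLabel N U θ n w} => exists_child_chainLabel hU hθ v.2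
  let next : {w : List ℕ // ∀ n, -2 < chainLabel N U θ n w} →
      {w : List ℕ // ∀ n, -2 < chainLabel N U θ n w} := fun v => ⟨v.1 ++ [f v], hf3 v⟩
  let p : ℕ → {w : List ℕ // ∀ n, -2 < chainLabel N U θ n w} := fun n => next^[n] ⟨[], h⟩
  have hp : ∀ n, (p (n + 1)).1 = (p n).1 ++ [f (p n)] := fun n => by
    simp only [p, Function.iterate_succ_apply', next]
  refine ⟨fun n => (p n).1, rfl, fun n => ?_, fun n => ⟨f (p n), hp n⟩,
    strictMono_nat_of_lt_succ fun n => ?_⟩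
  · induction n with
    | zero =>
      intro w i hw
      simp [p] at hw
    | succ n ih =>
      simp only [hp n]
      exact append_singleton_mem_offspringTree ih (hf1 _)
  · simp only [hp n, rmfLabel, List.length_append, List.length_singleton]
    push_cast
    linarith [hf2 (p n)]

end Deterministic

/-! ### Measurability and independence of subtrees -/

/-- Only the variables at descendants of `w` are assumed measurable, so the lemma also applies to
the σ-algebra generated by a subtree. -/
lemma measurable_chainLabel {Ω : Type*} [MeasurableSpace Ω] {N : List ℕ → Ω → ℕ}
    {U : List ℕ → Ω → ℝ} (θ : ℝ) (n : ℕ) (w : List ℕ) (hN : ∀ v, w <+: v → Measurable (N v))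
    (hU : ∀ v, w <+: v → Measurable (U v)) :
    Measurable fun ω => chainLabel (fun v => N v ω) (fun v => U v ω) θ n w := by
  induction n generalizing w with
  | zero => exact hU w (List.prefix_refl w)
  | succ n ih =>
    simp only [chainLabel]
    refine Measurable.ite ?_ (hU w (List.prefix_refl w)) measurable_const
    have : {ω | ∃ i < N w ω, U w ω - θ <
        chainLabel (fun v => N v ω) (fun v => U v ω) θ n (w ++ [i])} =
        ⋃ i : ℕ, {ω | i < N w ω} ∩ {ω | U w ω - θ <
          chainLabel (fun v => N v ω) (fun v => U v ω) θ n (w ++ [i])} := by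
      ext ω
      simp
    rw [this]
    refine MeasurableSet.iUnion fun i => MeasurableSet.inter ?_ ?_
    · exact measurableSet_lt measurable_const (hN w (List.prefix_refl w))
    · exact measurableSet_lt ((hU w (List.prefix_refl w)).sub_const θ)
        (ih _ (fun v hv => hN v ((List.prefix_append w [i]).trans hv))
          fun v hv => hU v ((List.prefix_append w [i]).trans hv))

lemma ProbabilityTheory.iIndep.measure_biInter_le_pow {Ω ι : Type*} {mΩ : MeasurableSpace Ω}
    {P : Measure Ω} [IsProbabilityMeasure P] {m : ι → MeasurableSpace Ω} (hle : ∀ i, m i ≤ mΩ)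
    (hm : iIndep m P) {S : ℕ → Set ι} (hS : Pairwise fun i j => Disjoint (S i) (S j))
    {B : ℕ → Set Ω} (hB : ∀ i, MeasurableSet[⨆ v ∈ S i, m v] (B i)) {q : ENNReal}
    (hq : ∀ i, P (B i) ≤ q) (k : ℕ) : P (⋂ i ∈ Finset.range k, B i) ≤ q ^ k := by
  induction k with
  | zero => simp
  | succ k ih =>
    have hdis : Disjoint (⋃ i ∈ Finset.range k, S i) (S k) := by
      simp only [Set.disjoint_iUnion_left]
      exact fun i hi => hS (Finset.mem_range.1 hi).ne
    have hind := indep_iSup_of_disjoint hle hm hdis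
    have hmeas : MeasurableSet[⨆ v ∈ ⋃ i ∈ Finset.range k, S i, m v]
        (⋂ i ∈ Finset.range k, B i) := by
      refine Finset.measurableSet_biInter _ fun i hi => ?_
      exact (biSup_mono (f := m) fun v hv => Set.mem_biUnion (Finset.mem_coe.2 hi) hv) _ (hB i)
    have hsplit : ⋂ i ∈ Finset.range (k + 1), B i = (⋂ i ∈ Finset.range k, B i) ∩ B k := by
      rw [Finset.range_add_one, Finset.set_biInter_insert, Set.inter_comm]
    rw [hsplit, (Indep_iff _ _ _).1 hind _ _ hmeas (hB k), pow_succ]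
    exact mul_le_mul' ih (hq k)

section Probability

variable {Ω : Type*} [MeasurableSpace Ω] {P : Measure Ω} {ν : Measure ℕ}
  {N : List ℕ → Ω → ℕ} {U : List ℕ → Ω → ℝ}

lemma IsBGWWithUniforms.iIndepFun_prodMk [IsProbabilityMeasure P]
    (h : IsBGWWithUniforms P ν N U) : iIndepFun (fun v ω => (N v ω, U v ω)) P := by
  let π : List ℕ → Set (Set Ω) := fun v =>
    {s | ∃ A : Set ℕ, ∃ B : Set ℝ, MeasurableSet B ∧ s = N v ⁻¹' A ∩ U v ⁻¹' B}
  have hZ : ∀ v, Measurable fun ω => (N v ω, U v ω) :=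
    fun v => (h.measurable_offspring v).prodMk (h.measurable_uniform v)
  refine iIndepSets.iIndep (fun v => (hZ v).comap_le) π ?_ ?_ ?_
  · rintro v _ ⟨A, B, hB, rfl⟩ _ ⟨A', B', hB', rfl⟩ -
    exact ⟨A ∩ A', B ∩ B', hB.inter hB', by ext; simp; tauto⟩
  · intro v
    rw [← generateFrom_prod, MeasurableSpace.comap_generateFrom]
    congr 1
    ext s
    constructor
    · rintro ⟨_, ⟨A, -, B, hB, rfl⟩, rfl⟩
      exact ⟨A, B, hB, rfl⟩
    · rintro ⟨A, B, hB, rfl⟩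
      exact ⟨A ×ˢ B, ⟨A, MeasurableSet.of_discrete (s := A), B, hB, rfl⟩, rfl⟩
  · rw [iIndepSets_iff]
    intro s f hf
    choose! A B hB hAB using hf
    have hmix : ∀ t : Finset (List ℕ), t ⊆ s →
        P ((⋂ v ∈ t, N v ⁻¹' A v) ∩ ⋂ v ∈ t, U v ⁻¹' B v)
          = (∏ v ∈ t, P (N v ⁻¹' A v)) * ∏ v ∈ t, P (U v ⁻¹' B v) := by
      intro t hts
      have h1 : (⋂ v ∈ t, N v ⁻¹' A v)
          = (fun ω v => N v ω) ⁻¹' (⋂ v ∈ t, (fun x : List ℕ → ℕ => x v) ⁻¹' A v) := by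
        ext; simp
      have h2 : (⋂ v ∈ t, U v ⁻¹' B v)
          = (fun ω v => U v ω) ⁻¹' (⋂ v ∈ t, (fun x : List ℕ → ℝ => x v) ⁻¹' B v) := by
        ext; simp
      rw [← h.indep_offspring.measure_inter_preimage_eq_mul t fun v _ => .of_discrete,
        ← h.indep_uniform.measure_inter_preimage_eq_mul t fun v hv => hB v (hts hv), h1, h2]
      refine h.indep_offspring_uniform.measure_inter_preimage_eq_mul _ _ ?_ ?_
      · exact Finset.measurableSet_biInter _ fun v _ => measurable_pi_apply v .of_discrete
      · exact Finset.measurableSet_biInter _ fun v hv => measurable_pi_apply v (hB v (hts hv))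
    have hall := hmix s subset_rfl
    have hset : ⋂ v ∈ s, f v = (⋂ v ∈ s, N v ⁻¹' A v) ∩ ⋂ v ∈ s, U v ⁻¹' B v := by
      rw [Set.iInter₂_congr hAB]
      simp only [Set.iInter_inter_distrib]
    rw [hset, hall, ← Finset.prod_mul_distrib]
    refine Finset.prod_congr rfl fun v hv => ?_
    rw [hAB v hv]
    -- The singleton case splits the probability of one rectangle.
    have := hmix {v} (Finset.singleton_subset_iff.2 hv)
    simpa using this.symm

lemma disjoint_subtrees (w : List ℕ) :
    Pairwise fun i j => Disjoint {v : List ℕ | w ++ [i] <+: v} {v | w ++ [j] <+: v} := by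
  intro i j hij
  rw [Set.disjoint_left]
  intro v hi hj
  have := List.prefix_of_prefix_length_le hi hj (by simp)
  exact hij (by simpa using this)

lemma IsBGWWithUniforms.map_prodMk [IsProbabilityMeasure P] (h : IsBGWWithUniforms P ν N U)
    (w : List ℕ) : P.map (fun ω => (N w ω, U w ω))
      = ν.prod (volume.restrict (Set.Ioo (0 : ℝ) 1)) := by
  have hind : IndepFun (N w) (U w) P :=
    h.indep_offspring_uniform.comp (measurable_pi_apply w) (measurable_pi_apply w)
  rw [hind.map_prod_eq_prod_map_map (h.measurable_offspring w).aemeasurable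
    (h.measurable_uniform w).aemeasurable, h.law_offspring, h.law_uniform]

/-! ### Survival with positive probability -/

lemma ofReal_mul_subEigen_le_lintegral {θ δ : ℝ} (h0 : 0 < θ) (h1 : θ ≤ 1) (hδ : 0 ≤ δ) {u : ℝ}
    (hu : u ≤ 1) : ENNReal.ofReal (δ * (θ * (2 - θ) * subEigen θ u))
      ≤ ∫⁻ y in Set.Ioo 0 1 ∩ Set.Ioi (u - θ), ENNReal.ofReal (δ * subEigen θ y) := by
  have hset : Set.Ioo (0 : ℝ) 1 ∩ Set.Ioi (u - θ) = Set.Ioo (max 0 (u - θ)) 1 := by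
    ext y
    simp only [Set.mem_inter_iff, Set.mem_Ioo, Set.mem_Ioi, max_lt_iff]
    tauto
  have hb1 : max 0 (u - θ) ≤ 1 := max_le zero_le_one (by linarith)
  have hc : Continuous fun y => δ * subEigen θ y := (continuous_subEigen θ).const_mul δ
  rw [hset, ← ofReal_integral_eq_lintegral_ofReal
      (hc.integrableOn_Icc.mono_set Set.Ioo_subset_Icc_self)
      (Eventually.of_forall fun y => mul_nonneg hδ (subEigen_nonneg θ y)),
    ← integral_Ioc_eq_integral_Ioo, ← intervalIntegral.integral_of_le hb1,
    intervalIntegral.integral_const_mul]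
  exact ENNReal.ofReal_le_ofReal
    (mul_le_mul_of_nonneg_left (mul_subEigen_le_integral h0 h1 hu) hδ)

/-- If each child independently has an accessible path above `a` with probability at least `z`, then
one of the first `k` children has with probability at least `1 - (1 - z) ^ k`. -/
lemma IsBGWWithUniforms.measure_exists_child_ge [IsProbabilityMeasure P]
    (h : IsBGWWithUniforms P ν N U) (θ : ℝ) (n : ℕ) (w : List ℕ) {a z : ℝ} (hz : z ≤ 1)
    (hV : ∀ i, ENNReal.ofReal z ≤
      P {ω | a < chainLabel (fun v => N v ω) (fun v => U v ω) θ n (w ++ [i])}) (k : ℕ) :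
    ENNReal.ofReal (1 - (1 - z) ^ k) ≤
      P {ω | ∃ i < k, a < chainLabel (fun v => N v ω) (fun v => U v ω) θ n (w ++ [i])} := by
  have hZ : ∀ v, Measurable fun ω => (N v ω, U v ω) :=
    fun v => (h.measurable_offspring v).prodMk (h.measurable_uniform v)
  set V : ℕ → Ω → ℝ := fun i ω => chainLabel (fun v => N v ω) (fun v => U v ω) θ n (w ++ [i])
    with hVdef
  have hVm : ∀ i, Measurable (V i) := fun i => measurable_chainLabel θ n _
    (fun v _ => h.measurable_offspring v) fun v _ => h.measurable_uniform v
  have hB : ∀ i, MeasurableSet[⨆ v ∈ {v : List ℕ | w ++ [i] <+: v},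
      MeasurableSpace.comap (fun ω => (N v ω, U v ω)) inferInstance] {ω | V i ω ≤ a} := by
    intro i
    have hsub : ∀ v, w ++ [i] <+: v → Measurable[⨆ v ∈ {v : List ℕ | w ++ [i] <+: v},
        MeasurableSpace.comap (fun ω => (N v ω, U v ω)) inferInstance]
          (fun ω => (N v ω, U v ω)) := fun v hv =>
      Measurable.mono (comap_measurable _) (le_biSup (fun v : List ℕ =>
        MeasurableSpace.comap (fun ω => (N v ω, U v ω)) inferInstance) hv) le_rfl
    exact @measurable_chainLabel Ω (_) N U θ n (w ++ [i])
      (fun v hv => measurable_fst.comp (hsub v hv)) (fun v hv => measurable_snd.comp (hsub v hv))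
      _ (measurableSet_Iic (a := a))
  have hq : ∀ i, P {ω | V i ω ≤ a} ≤ ENNReal.ofReal (1 - z) := by
    intro i
    have hc : {ω | V i ω ≤ a} = {ω | a < V i ω}ᶜ := by
      ext ω
      simp
    rw [hc, prob_compl_eq_one_sub (measurableSet_lt measurable_const (hVm i))]
    rcases le_total 0 z with hz0 | hz0
    · rw [ENNReal.ofReal_sub _ hz0, ENNReal.ofReal_one]
      exact tsub_le_tsub_left (hV i) _
    · refine tsub_le_self.trans ?_
      rw [ENNReal.one_le_ofReal]
      linarith
  have hpow := iIndep.measure_biInter_le_pow (fun v => (hZ v).comap_le)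
    h.iIndepFun_prodMk (disjoint_subtrees w) hB hq k
  have hset : {ω | ∃ i < k, a < V i ω} = (⋂ i ∈ Finset.range k, {ω | V i ω ≤ a})ᶜ := by
    ext ω
    simp
  rw [hset, prob_compl_eq_one_sub (Finset.measurableSet_biInter _ fun i _ =>
    measurableSet_le (hVm i) measurable_const), ENNReal.ofReal_sub _ (pow_nonneg (by linarith) _),
    ENNReal.ofReal_one, ENNReal.ofReal_pow (by linarith)]
  exact tsub_le_tsub_left hpow _

lemma IsBGWWithUniforms.indepFun_children [IsProbabilityMeasure P]
    (h : IsBGWWithUniforms P ν N U) (θ : ℝ) (n : ℕ) (w : List ℕ) :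
    IndepFun (fun ω => (N w ω, U w ω))
      (fun ω i => chainLabel (fun v => N v ω) (fun v => U v ω) θ n (w ++ [i])) P := by
  have hZ : ∀ v, Measurable fun ω => (N v ω, U v ω) :=
    fun v => (h.measurable_offspring v).prodMk (h.measurable_uniform v)
  have hdis : Disjoint ({w} : Set (List ℕ)) {v | ∃ i, w ++ [i] <+: v} := by
    rw [Set.disjoint_singleton_left]
    rintro ⟨i, hi⟩
    have := hi.length_le
    simp at this
  have hind := indep_iSup_of_disjoint (fun v => (hZ v).comap_le) h.iIndepFun_prodMk hdis
  rw [iSup_singleton] at hind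
  refine indep_of_indep_of_le_right hind ?_
  have hsub : ∀ v, (∃ i, w ++ [i] <+: v) → Measurable[⨆ v ∈ {v : List ℕ | ∃ i, w ++ [i] <+: v},
      MeasurableSpace.comap (fun ω => (N v ω, U v ω)) inferInstance]
        (fun ω => (N v ω, U v ω)) := fun v hv =>
    Measurable.mono (comap_measurable _) (le_biSup (fun v : List ℕ =>
      MeasurableSpace.comap (fun ω => (N v ω, U v ω)) inferInstance) hv) le_rfl
  refine Measurable.comap_le (@measurable_pi_lambda _ _ _ (_) _ _ fun i => ?_)
  exact @measurable_chainLabel Ω (_) N U θ n (w ++ [i])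
    (fun v hv => measurable_fst.comp (hsub v ⟨i, hv⟩))
    fun v hv => measurable_snd.comp (hsub v ⟨i, hv⟩)

/-- Induction on `n`, for all `w` and `b` together. Given `U w = u`, each child succeeds with
probability at least `z = δ λ φ(u)`, by the induction hypothesis at level `u - θ` and `T φ ≥ λ φ`.
Some child then succeeds with probability at least `E[1-(1-z)^L] ≥ z/λ = δ φ(u)`, the density
required. -/
lemma IsBGWWithUniforms.lintegral_subEigen_le [IsProbabilityMeasure P] [IsProbabilityMeasure ν]
    (h : IsBGWWithUniforms P ν N U) {θ δ : ℝ} (h0 : 0 < θ) (h1 : θ ≤ 1) (hδ0 : 0 < δ) (hδ1 : δ ≤ 1)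
    (hδ : ∀ z, 0 ≤ z → z ≤ δ → 1 / (θ * (2 - θ)) * z ≤ ∫ k : ℕ, (1 - (1 - z) ^ k) ∂ν)
    (n : ℕ) (w : List ℕ) (b : ℝ) :
    ∫⁻ y in Set.Ioo 0 1 ∩ Set.Ioi b, ENNReal.ofReal (δ * subEigen θ y)
      ≤ P {ω | b < chainLabel (fun v => N v ω) (fun v => U v ω) θ n w} := by
  have hl := subEigen_rate_pos h0 h1
  have hl1 : θ * (2 - θ) ≤ 1 := by nlinarith [sq_nonneg (1 - θ)]
  induction n generalizing w b with
  | zero =>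
    have hP : P {ω | b < U w ω} = volume (Set.Ioo 0 1 ∩ Set.Ioi b) := by
      rw [show {ω | b < U w ω} = U w ⁻¹' Set.Ioi b from rfl,
        ← Measure.map_apply (h.measurable_uniform w) measurableSet_Ioi, h.law_uniform,
        Measure.restrict_apply measurableSet_Ioi, Set.inter_comm]
    simp only [chainLabel]
    rw [hP, ← setLIntegral_one]
    refine lintegral_mono fun y => ?_
    rw [ENNReal.ofReal_le_one]
    exact mul_le_one₀ hδ1 (subEigen_nonneg θ y) (subEigen_le_one h0 h1 y)
  | succ n ih =>
    set Z : Ω → ℕ × ℝ := fun ω => (N w ω, U w ω) with hZ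
    set V : Ω → ℕ → ℝ :=
      fun ω i => chainLabel (fun v => N v ω) (fun v => U v ω) θ n (w ++ [i]) with hV
    have hZm : Measurable Z := (h.measurable_offspring w).prodMk (h.measurable_uniform w)
    have hVm : Measurable V := measurable_pi_lambda _ fun i => measurable_chainLabel θ n _
      (fun v _ => h.measurable_offspring v) fun v _ => h.measurable_uniform v
    set A : Set ((ℕ × ℝ) × (ℕ → ℝ)) := {x | b < x.1.2 ∧ ∃ i < x.1.1, x.1.2 - θ < x.2 i} with hA
    have hAm : MeasurableSet A := by
      have : A = {x | b < x.1.2} ∩ ⋃ i : ℕ, ({x | i < x.1.1} ∩ {x | x.1.2 - θ < x.2 i}) := by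
        ext x
        simp [hA]
      rw [this]
      refine (measurableSet_lt (by fun_prop) (by fun_prop)).inter
        (MeasurableSet.iUnion fun i => (measurableSet_lt ?_ ?_).inter (measurableSet_lt ?_ ?_)) <;>
        fun_prop
    have hsub : (fun ω => (Z ω, V ω)) ⁻¹' A ⊆
        {ω | b < chainLabel (fun v => N v ω) (fun v => U v ω) θ (n + 1) w} := by
      rintro ω ⟨hb, hex⟩
      simp only [Set.mem_ofPred_eq, chainLabel]
      rw [if_pos hex]
      exact hb
    refine le_trans ?_ (measure_mono hsub)
    rw [← Measure.map_apply (hZm.prodMk hVm) hAm,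
      (h.indepFun_children θ n w).map_prod_eq_prod_map_map hZm.aemeasurable hVm.aemeasurable,
      Measure.prod_apply hAm, h.map_prodMk w]
    have hsec : ∀ k : ℕ, ∀ u : ℝ, u ≤ 1 →
        (Set.Ioi b).indicator (fun u => ENNReal.ofReal
          (1 - (1 - δ * (θ * (2 - θ) * subEigen θ u)) ^ k)) u
          ≤ P.map V (Prod.mk (k, u) ⁻¹' A) := by
      intro k u hu
      by_cases hb : b < u
      · rw [Set.indicator_of_mem (Set.mem_Ioi.2 hb),
          Measure.map_apply hVm (measurable_prodMk_left hAm)]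
        have hz1 : δ * (θ * (2 - θ) * subEigen θ u) ≤ 1 :=
          mul_le_one₀ hδ1 (mul_nonneg hl.le (subEigen_nonneg θ u))
            (mul_le_one₀ hl1 (subEigen_nonneg θ u) (subEigen_le_one h0 h1 u))
        refine (h.measure_exists_child_ge θ n w hz1 (fun i =>
          (ofReal_mul_subEigen_le_lintegral h0 h1 hδ0.le hu).trans (ih (w ++ [i]) (u - θ)))
          k).trans (measure_mono ?_)
        exact fun ω hω => ⟨hb, hω⟩
      · rw [Set.indicator_of_notMem (by simpa using hb)]
        exact zero_le
    have hmeas : Measurable fun x : ℕ × ℝ => (Set.Ioi b).indicator (fun u => ENNReal.ofReal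
        (1 - (1 - δ * (θ * (2 - θ) * subEigen θ u)) ^ x.1)) x.2 := by
      refine measurable_from_prod_countable_right fun k => ?_
      refine Measurable.indicator ?_ measurableSet_Ioi
      have := (continuous_subEigen θ).measurable
      fun_prop
    calc ∫⁻ y in Set.Ioo 0 1 ∩ Set.Ioi b, ENNReal.ofReal (δ * subEigen θ y)
        = ∫⁻ u in Set.Ioo 0 1, (Set.Ioi b).indicator
            (fun u => ENNReal.ofReal (δ * subEigen θ u)) u := by
          rw [setLIntegral_indicator measurableSet_Ioi, Set.inter_comm]
      _ ≤ ∫⁻ u in Set.Ioo 0 1, ∫⁻ k, (Set.Ioi b).indicator (fun u => ENNReal.ofReal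
            (1 - (1 - δ * (θ * (2 - θ) * subEigen θ u)) ^ k)) u ∂ν := by
          refine lintegral_mono fun u => ?_
          by_cases hb : u ∈ Set.Ioi b
          · simp only [Set.indicator_of_mem hb]
            have hz0 : 0 ≤ δ * (θ * (2 - θ) * subEigen θ u) :=
              mul_nonneg hδ0.le (mul_nonneg hl.le (subEigen_nonneg θ u))
            have hzδ : δ * (θ * (2 - θ) * subEigen θ u) ≤ δ :=
              mul_le_of_le_one_right hδ0.le
                (mul_le_one₀ hl1 (subEigen_nonneg θ u) (subEigen_le_one h0 h1 u))
            have hp : ∀ k : ℕ, 0 ≤ (1 - δ * (θ * (2 - θ) * subEigen θ u)) ^ k ∧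
                (1 - δ * (θ * (2 - θ) * subEigen θ u)) ^ k ≤ 1 := fun k =>
              ⟨pow_nonneg (by linarith) k, pow_le_one₀ (by linarith) (by linarith)⟩
            rw [← ofReal_integral_eq_lintegral_ofReal]
            · refine ENNReal.ofReal_le_ofReal ((le_of_eq ?_).trans (hδ _ hz0 hzδ))
              rw [one_div, mul_left_comm, inv_mul_cancel_left₀ hl.ne']
            · refine (integrable_const (1 : ℝ)).mono (measurable_of_countable _).aestronglyMeasurable
                (Eventually.of_forall fun k => ?_)
              rw [Real.norm_of_nonneg (by linarith [hp k])]
              simpa using (hp k).1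
            · exact Eventually.of_forall fun k => by simpa using (hp k).2
          · simp only [Set.indicator_of_notMem hb]
            exact zero_le
      _ = ∫⁻ x, (Set.Ioi b).indicator (fun u => ENNReal.ofReal
            (1 - (1 - δ * (θ * (2 - θ) * subEigen θ u)) ^ x.1)) x.2
              ∂(ν.prod (volume.restrict (Set.Ioo (0 : ℝ) 1))) :=
          (lintegral_prod_symm _ hmeas.aemeasurable).symm
      _ ≤ ∫⁻ x, P.map V (Prod.mk x ⁻¹' A) ∂(ν.prod (volume.restrict (Set.Ioo (0 : ℝ) 1))) := by
          refine lintegral_mono_ae ?_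
          have : ∀ᵐ x ∂(ν.prod (volume.restrict (Set.Ioo (0 : ℝ) 1))), x.2 ∈ Set.Ioo (0 : ℝ) 1 :=
            Measure.quasiMeasurePreserving_snd.ae (ae_restrict_mem measurableSet_Ioo)
          filter_upwards [this] with x hx
          exact hsec x.1 x.2 hx.2.le

lemma IsBGWWithUniforms.percolation_pos [IsProbabilityMeasure P] [IsProbabilityMeasure ν]
    (h : IsBGWWithUniforms P ν N U) {θ : ℝ} (h0 : 0 < θ) (h1 : θ ≤ 1)
    (hint : Integrable (fun k : ℕ => (k : ℝ)) ν)
    (hsuper : 1 < (∫ k : ℕ, (k : ℝ) ∂ν) * (θ * (2 - θ))) :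
    0 < P (percolationEvent N U θ) := by
  have hl := subEigen_rate_pos h0 h1
  obtain ⟨δ, hδ0, hδ1, hδ⟩ := exists_survival_bound ν hint
    (c := 1 / (θ * (2 - θ))) (by rwa [div_lt_iff₀ hl])
  have hE : ∀ᵐ ω ∂P, ∀ v, U v ω ∈ Set.Ioo (0 : ℝ) 1 := by
    rw [ae_all_iff]
    intro v
    refine ae_of_ae_map (h.measurable_uniform v).aemeasurable ?_
    rw [h.law_uniform]
    exact ae_restrict_mem measurableSet_Ioo
  set E : Set Ω := {ω | ∀ v, U v ω ∈ Set.Ioo (0 : ℝ) 1} with hEdef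
  have hEm : MeasurableSet E := by
    have : E = ⋂ v, U v ⁻¹' Set.Ioo 0 1 := by
      ext ω
      simp [hEdef]
    rw [this]
    exact MeasurableSet.iInter fun v => h.measurable_uniform v measurableSet_Ioo
  -- The level `0 - θ` is the one seen from a parent at `u = 0`, where `φ = 1`; this gives the bound
  -- `δ λ` for every `n`. It exceeds `-2`, so passing it excludes the default value.
  set B : ℕ → Set Ω := fun n =>
    E ∩ {ω | 0 - θ < chainLabel (fun v => N v ω) (fun v => U v ω) θ n []} with hB
  have hBm : ∀ n, MeasurableSet (B n) := fun n => hEm.inter (measurableSet_lt measurable_const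
    (measurable_chainLabel θ n _ (fun v _ => h.measurable_offspring v)
      fun v _ => h.measurable_uniform v))
  have hBanti : Antitone B := by
    rintro i j hij ω ⟨hω, hlt⟩
    exact ⟨hω, lt_of_lt_of_le hlt
      (antitone_chainLabel (fun v => by linarith [(hω v).1]) [] hij)⟩
  have hBge : ∀ n, ENNReal.ofReal (δ * (θ * (2 - θ) * subEigen θ 0)) ≤ P (B n) := by
    intro n
    simp only [hB]
    rw [Set.inter_comm, measure_inter_conull (by exact hE)]
    exact (ofReal_mul_subEigen_le_lintegral h0 h1 hδ0.le zero_le_one).trans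
      (h.lintegral_subEigen_le h0 h1 hδ0 hδ1 hδ n [] _)
  have hlim := tendsto_measure_iInter_atTop (fun n => (hBm n).nullMeasurableSet) hBanti
    ⟨0, measure_ne_top P _⟩
  have hpos : 0 < ENNReal.ofReal (δ * (θ * (2 - θ) * subEigen θ 0)) := by
    rw [ENNReal.ofReal_pos, subEigen_eq_one h0.le, mul_one]
    exact mul_pos hδ0 hl
  -- The percolation event contains `⋂ n, B n`, so its own measurability is not needed.
  refine hpos.trans_le ((ge_of_tendsto' hlim hBge).trans (measure_mono ?_))
  intro ω hω
  rw [Set.mem_iInter] at hω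
  exact accessibilityPercolation_of_chainLabel (fun v => by linarith [((hω 0).1 v).1]) h1
    fun n => lt_of_le_of_lt (by linarith) (hω n).2

end Probability

/-- With `θ_c(m)` understood in both of its senses: as the critical parameter of the percolation
model, and as the solution `t ∈ (0,1]` of `m_c(t) = m`. -/
theorem proposition1p5
    {Ω : Type*} [MeasurableSpace Ω] (P : Measure Ω) [IsProbabilityMeasure P]
    (ν : Measure ℕ) [IsProbabilityMeasure ν]
    (N : List ℕ → Ω → ℕ) (U : List ℕ → Ω → ℝ) (hNU : IsBGWWithUniforms P ν N U)
    (m : ℝ) (hm : 1 ≤ m)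
    (hmean : Integrable (fun k : ℕ => (k : ℝ)) ν ∧ ∫ k : ℕ, (k : ℝ) ∂ν = m)
    (hLlogL : Integrable (fun k : ℕ => (k : ℝ) * Real.posLog (k : ℝ)) ν) :
    (∀ θ : ℝ, 0 ≤ θ → θ ≤ 1 → 1 - √(1 - 1 / m) < θ → 0 < P (percolationEvent N U θ)) ∧
    criticalTheta P N U ≤ 1 - √(1 - 1 / m) ∧
    (∀ t : ℝ, 0 < t → t ≤ 1 → IsCriticalMean t m → t ≤ 1 - √(1 - 1 / m)) ∧
    (fun x : ℝ => 1 - √(1 - 1 / x)) ~[atTop] (fun x : ℝ => 1 / (2 * x)) := by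
  have hperc : ∀ θ : ℝ, 0 ≤ θ → θ ≤ 1 → 1 - √(1 - 1 / m) < θ →
      0 < P (percolationEvent N U θ) := by
    intro θ _ h1 hθ
    refine hNU.percolation_pos ((sqrt_bound_nonneg hm).trans_lt hθ) h1 hmean.1 ?_
    rw [hmean.2]
    exact one_lt_mul_of_lt hm h1 hθ
  refine ⟨hperc, ?_, ?_, isEquivalent_sqrt_bound⟩
  · refine Real.sSup_le ?_ (sqrt_bound_nonneg hm)
    rintro θ ⟨h0, h1, hP⟩
    by_contra! hlt
    exact (hperc θ h0 h1 hlt).ne' hP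
  · intro t h0 h1 hcrit
    by_contra! hlt
    exact (one_lt_mul_of_lt hm h1 hlt).not_ge (hcrit.le_inv h0 h1)
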